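/- **Theorem 4.3.** Let $J$ denote the counteridentity matrix (ones on the antidiagonal, zeros elsewhere) of the appropriate size; an $n\times n$ real matrix $C$ is *centrosymmetric* if $JCJ=C$, and *nonnegative* if all its entries are nonnegative. Let $\mathcal{CR}_n$ be the collection of all lists (multisets) of $n$ complex numbers that are the spectrum, counted with algebraic multiplicity, of some $n\times n$ nonnegative centrosymmetric matrix. Let $C$ be an $n\times n$ nonnegative centrosymmetric matrix with spectrum $\Lambda=\{\lambda_1,a+ib,a-ib,\lambda_4,\ldots,\lambda_n\}$, where $a,b$ are real, $b>0$ and $\lambda_1=\max_{\lambda\in\Lambda}|\lambda|$ is the Perron eigenvalue of $C$. With $m=\lfloor n/2\rfloor$, let $A$ be the upper left $m\times m$ block of $C$ (first $m$ rows and first $m$ columns) and $B$ its lower left $m\times m$ block (last $m$ rows and first $m$ columns). Put $\delta=2$ if $a\pm ib$ are eigenvalues of $A-JB$, and $\delta=4$ otherwise. Then for all $t\ge 0$, $$\Lambda_t^-=\{\lambda_1+2t,\;a-t+ib,\;a-t-ib,\;\lambda_4,\ldots,\lambda_n\}\in\mathcal{CR}_n,$$ $$\Lambda_t^+=\{\lambda_1+\delta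 t,\;a+t+ib,\;a+t-ib,\;\lambda_4,\ldots,\lambda_n\}\in\mathcal{CR}_n.$$ -/

import Mathlib

noncomputable section

/-- The `n × n` counteridentity matrix `J`: ones on the antidiagonal, zeros elsewhere. -/
def counteridentity (n : ℕ) : Matrix (Fin n) (Fin n) ℝ :=
  Matrix.of fun i j => if j = Fin.rev i then 1 else 0

/-- A square real matrix is centrosymmetric if `J C J = C`. -/
def IsCentrosymmetric {n : ℕ} (C : Matrix (Fin n) (Fin n) ℝ) : Prop :=
  counteridentity n * C * counteridentity n = C

/-- A real matrix is nonnegative if all its entries are. -/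
def IsNonnegative {n : ℕ} (C : Matrix (Fin n) (Fin n) ℝ) : Prop :=
  ∀ i j, 0 ≤ C i j

/-- The spectrum of a real square matrix: the list of its complex eigenvalues, repeated according
to algebraic multiplicity. -/
def eigenvalueList {n : ℕ} (C : Matrix (Fin n) (Fin n) ℝ) : Multiset ℂ :=
  (C.map (fun x : ℝ => (x : ℂ))).charpoly.roots

/-- The collection of all lists of `n` complex numbers that are the spectrum of an `n × n`
nonnegative centrosymmetric matrix. -/
def centrosymmetricallyRealizable (n : ℕ) : Set (Multiset ℂ) :=
  {L | ∃ C : Matrix (Fin n) (Fin n) ℝ,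
    IsNonnegative C ∧ IsCentrosymmetric C ∧ eigenvalueList C = L}

/-- The upper left `m × m` block `A` of `C`, where `m = ⌊n / 2⌋`. -/
def upperLeftBlock {n : ℕ} (C : Matrix (Fin n) (Fin n) ℝ) :
    Matrix (Fin (n / 2)) (Fin (n / 2)) ℝ :=
  Matrix.of fun i j =>
    C ⟨(i : ℕ), by have := i.isLt; omega⟩ ⟨(j : ℕ), by have := j.isLt; omega⟩

/-- The lower left `m × m` block `B` of `C`, where `m = ⌊n / 2⌋`: the last `m` rows and the first
`m` columns (for odd `n`, the middle row and column belong to neither block). -/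
def lowerLeftBlock {n : ℕ} (C : Matrix (Fin n) (Fin n) ℝ) :
    Matrix (Fin (n / 2)) (Fin (n / 2)) ℝ :=
  Matrix.of fun i j =>
    C ⟨n - n / 2 + (i : ℕ), by have := i.isLt; omega⟩ ⟨(j : ℕ), by have := j.isLt; omega⟩

/-- The block `A - J B` of `C`, which carries the eigenvalues with skew-symmetric eigenvectors. -/
def skewSymmetricBlock {n : ℕ} (C : Matrix (Fin n) (Fin n) ℝ) :
    Matrix (Fin (n / 2)) (Fin (n / 2)) ℝ :=
  upperLeftBlock C - counteridentity (n / 2) * lowerLeftBlock C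

end

open Matrix Polynomial

/-! After a cospectral replacement, `C` has constant row sums `ρ`, and then `ρ = l₁`
(`exists_cospectral_const_row_sums`). An eigenvector for `a + ib` can be chosen symmetric or
skew-symmetric, and the skew ones correspond to the eigenvectors of `A - JB`.

Let the `r` columns of `V` span an invariant subspace: `Re x, Im x` for skew `x`, and `1, Re x, Im
x` for symmetric `x`. Rado's theorem gives a `K` with `K V = ±t I`, so that adding `V K` shifts
exactly the eigenvalues on that subspace by `±t`. Choosing the rows of a maximal minor of `V` bounds
the entries of `V K` by `t` times the column sums of a nonnegative `r × n` matrix with unit row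
sums. Adding these bounds to every row restores nonnegativity, and by Brauer's theorem this only
raises the row-sum eigenvalue, by `r t`. Symmetrizing `K` under reflection preserves centrosymmetry.
All this is `exists_perturbation`.

In the skew case `r = 2` and `ρ` itself is not shifted, so the cost is `2t` for either sign. In the
symmetric case `r = 3` and `ρ` moves along, so the cost is `3t ± t`: this is `2t` for the left shift
and `4t` for the right shift. -/

/-! ### Characteristic polynomials under low-rank perturbation. -/

/-- Rado's determinant identity: if the columns of `X` span a `P`-invariant subspace on which `P`
acts by `Q`, then the perturbation `P - X K` only changes `Q` to `Q - K X`. -/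
theorem det_sub_mul_mul_det {R m p : Type*} [CommRing R] [Fintype m] [Fintype p] [DecidableEq m]
    [DecidableEq p] (P : Matrix m m R) (Q : Matrix p p R) (X : Matrix m p R) (K : Matrix p m R)
    (h : P * X = X * Q) : (P - X * K).det * Q.det = P.det * (Q - K * X).det := by
  -- The first factor has determinant `det (P - X K)` by the Schur complement; the relation `P X = X
  -- Q` kills the upper right block of the product.
  have h1 : fromBlocks P X K 1 * fromBlocks 1 (-X) 0 Q = fromBlocks P 0 K (Q - K * X) := by
    rw [fromBlocks_multiply]
    congr 1 <;> simp [h]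
    abel
  have h2 := congrArg det h1
  rwa [det_mul, det_fromBlocks_one₂₂, det_fromBlocks_zero₂₁, det_fromBlocks_zero₁₂, det_one,
    one_mul] at h2

/-- The determinant identity is applied to `z - A` and `z - W` at every real `z`. The product form
avoids dividing by `W.charpoly`. -/
theorem charpoly_add_mul_mul_charpoly {n r : ℕ} (A : Matrix (Fin n) (Fin n) ℝ)
    (W : Matrix (Fin r) (Fin r) ℝ) (X : Matrix (Fin n) (Fin r) ℝ) (K : Matrix (Fin r) (Fin n) ℝ)
    (h : A * X = X * W) :
    (A + X * K).charpoly * W.charpoly = A.charpoly * (W + K * X).charpoly := by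
  refine Polynomial.funext fun z => ?_
  simp only [eval_mul, eval_charpoly, ← sub_sub]
  refine det_sub_mul_mul_det _ _ _ _ ?_
  simp [Matrix.sub_mul, Matrix.mul_sub, h, scalar_apply, ← smul_one_eq_diagonal]

/-- Brauer's theorem for the constant vector. -/
theorem charpoly_add_const_rows {n : ℕ} (A : Matrix (Fin n) (Fin n) ℝ) (ρ : ℝ) (k : Fin n → ℝ)
    (h : ∀ i, ∑ j, A i j = ρ) :
    (A + of fun _ j => k j).charpoly * (X - C ρ) = A.charpoly * (X - C (ρ + ∑ j, k j)) := by
  let U : Matrix (Fin n) (Fin 1) ℝ := of fun _ _ => 1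
  let K : Matrix (Fin 1) (Fin n) ℝ := of fun _ j => k j
  let D : ℝ → Matrix (Fin 1) (Fin 1) ℝ := fun x => of fun _ _ => x
  have key := charpoly_add_mul_mul_charpoly A (D ρ) U K
    (by ext i j; simp [U, D, Matrix.mul_apply, h])
  have e1 : U * K = of fun _ j => k j := by
    ext i j; simp [U, K, Matrix.mul_apply]
  have e2 : ∀ x : ℝ, (D x).charpoly = X - C x := by
    intro x; simp [D, charpoly, charmatrix_apply_eq]
  have e3 : D ρ + K * U = D (ρ + ∑ j, k j) := by
    ext i j; simp [D, K, U, Matrix.mul_apply]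
  rwa [e1, e3, e2, e2] at key

/-! ### Maximal minors. -/

theorem exists_det_submatrix_ne_zero {n r : ℕ} (V : Matrix (Fin n) (Fin r) ℝ)
    (hV : ∀ c, V *ᵥ c = 0 → c = 0) :
    ∃ i : Fin r → Fin n, (V.submatrix i id).det ≠ 0 := by
  have hrank : V.rank = r := by
    have := LinearMap.finrank_range_of_inj (f := V.mulVecLin)
      (LinearMap.ker_eq_bot.1 (LinearMap.ker_eq_bot'.2 hV))
    simpa [Matrix.rank] using this
  rw [rank_eq_finrank_span_row] at hrank
  obtain ⟨f, hf, -, hli⟩ := Submodule.exists_fun_fin_finrank_span_eq ℝ (Set.range V.row)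
  choose i hi using hf
  refine ⟨i ∘ Fin.cast hrank.symm, ?_⟩
  rw [← isUnit_iff_ne_zero, ← isUnit_iff_isUnit_det, ← linearIndependent_rows_iff_isUnit]
  have e : (V.submatrix (i ∘ Fin.cast hrank.symm) id).row = f ∘ Fin.cast hrank.symm :=
    funext fun a => hi (Fin.cast hrank.symm a)
  rw [e]
  exact hli.comp (Fin.cast hrank.symm) (Fin.cast_injective _)

/-- Some nonsingular choice of rows of an injective matrix expresses every row with coefficients
of absolute value at most one: take a maximal minor. -/
theorem exists_rows_coordinates_le_one {n r : ℕ} (V : Matrix (Fin n) (Fin r) ℝ)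
    (hV : ∀ c, V *ᵥ c = 0 → c = 0) :
    ∃ i : Fin r → Fin n, IsUnit (V.submatrix i id).det ∧
      ∀ j k, |(V * (V.submatrix i id)⁻¹) j k| ≤ 1 := by
  obtain ⟨i₀, hi₀⟩ := exists_det_submatrix_ne_zero V hV
  have : Nonempty (Fin r → Fin n) := ⟨i₀⟩
  obtain ⟨i, hi⟩ := Finite.exists_max fun i : Fin r → Fin n => |(V.submatrix i id).det|
  have hpos : 0 < |(V.submatrix i id).det| := (abs_pos.2 hi₀).trans_le (hi i₀)
  refine ⟨i, (abs_pos.1 hpos).isUnit, fun j k => ?_⟩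
  -- Cramer's rule: each coordinate is a quotient of two `r × r` minors, with the maximal one as
  -- denominator.
  have h1 : (V * (V.submatrix i id).adjugate) j k
      = (V.submatrix (Function.update i k j) id).det := by
    have e : V.submatrix (Function.update i k j) id = (V.submatrix i id).updateRow k (V j) := by
      ext a b
      by_cases ha : a = k
      · subst ha; simp
      · simp [Matrix.updateRow_ne ha, Function.update_of_ne ha]
    rw [e, ← cramer_transpose_apply, cramer_eq_adjugate_mulVec, ← adjugate_transpose,
      mulVec_transpose]
    rfl
  have h2 : (V * (V.submatrix i id)⁻¹) j k
      = (V.submatrix (Function.update i k j) id).det / (V.submatrix i id).det := by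
    rw [inv_def, Matrix.mul_smul, Matrix.smul_apply, h1, Ring.inverse_eq_inv', smul_eq_mul]
    field_simp
  rw [h2, abs_div, div_le_one hpos]
  exact hi _

/-! ### Reflection and the centrosymmetric perturbation. -/

theorem counteridentity_mul {n : ℕ} {m : Type*} (M : Matrix (Fin n) m ℝ) (i : Fin n) (j : m) :
    (counteridentity n * M) i j = M (Fin.rev i) j := by
  simp [counteridentity, Matrix.mul_apply]

theorem mul_counteridentity {n : ℕ} {m : Type*} (M : Matrix m (Fin n) ℝ) (i : m) (j : Fin n) :
    (M * counteridentity n) i j = M i (Fin.rev j) := by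
  simp [counteridentity, Matrix.mul_apply, ← Fin.rev_eq_iff]

theorem isCentrosymmetric_iff {n : ℕ} {A : Matrix (Fin n) (Fin n) ℝ} :
    IsCentrosymmetric A ↔ ∀ i j, A (Fin.rev i) (Fin.rev j) = A i j := by
  simp [IsCentrosymmetric, ← Matrix.ext_iff, mul_counteridentity, counteridentity_mul]

/-- The `r × n` matrix whose row `k` is `½ (e_{i k} + s e_{rev (i k)})`. -/
noncomputable def reflectedSelection {n r : ℕ} (i : Fin r → Fin n) (s : ℝ) : Matrix (Fin r) (Fin n) ℝ :=
  of fun k j => ((if j = i k then 1 else 0) + s * (if j = Fin.rev (i k) then 1 else 0)) / 2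

theorem reflectedSelection_mul {n r : ℕ} {m : Type*} (i : Fin r → Fin n) (s : ℝ)
    (M : Matrix (Fin n) m ℝ) (k : Fin r) (l : m) :
    (reflectedSelection i s * M) k l = (M (i k) l + s * M (Fin.rev (i k)) l) / 2 := by
  simp only [reflectedSelection, Matrix.mul_apply, of_apply]
  have : ∀ j, (((if j = i k then 1 else 0) + s * (if j = Fin.rev (i k) then 1 else 0)) / 2) * M j l
      = ((if j = i k then M j l else 0) + s * (if j = Fin.rev (i k) then M j l else 0)) / 2 := by
    intro j; split_ifs <;> ring
  simp only [this, ← Finset.sum_div, Finset.sum_add_distrib, ← Finset.mul_sum]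
  simp

theorem reflectedSelection_row_sum {n r : ℕ} (i : Fin r → Fin n) (s : ℝ) (k : Fin r) :
    ∑ j, reflectedSelection i s k j = (1 + s) / 2 := by
  have := reflectedSelection_mul i s (of fun _ _ => 1 : Matrix (Fin n) Unit ℝ) k ()
  simpa [Matrix.mul_apply] using this

theorem reflectedSelection_rev {n r : ℕ} (i : Fin r → Fin n) {s : ℝ} (hs : s * s = 1)
    (k : Fin r) (j : Fin n) :
    reflectedSelection i s k (Fin.rev j) = s * reflectedSelection i s k j := by
  simp only [reflectedSelection, of_apply, Fin.rev_eq_iff (i := j), Fin.rev_rev]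
  have h : ∀ x y : ℝ, (x + s * y) / 2 = s * ((y + s * x) / 2) := fun x y => by
    linear_combination -(x / 2) * hs
  exact h _ _

theorem abs_reflectedSelection_le {n r : ℕ} (i : Fin r → Fin n) {s : ℝ} (hs : |s| = 1)
    (k : Fin r) (j : Fin n) :
    |reflectedSelection i s k j| ≤ reflectedSelection i 1 k j := by
  simp only [reflectedSelection, of_apply, abs_div, abs_two]
  gcongr
  refine (abs_add_le _ _).trans ?_
  rw [abs_mul, hs]
  split_ifs <;> simp

/-- Perturbing a nonnegative centrosymmetric matrix with constant row sums along an invariant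
subspace of symmetric (`s = 1`) or skew-symmetric (`s = -1`) vectors. -/
theorem exists_perturbation {n r : ℕ} {A : Matrix (Fin n) (Fin n) ℝ} (hA : IsNonnegative A)
    (hcen : IsCentrosymmetric A) {ρ : ℝ} (hρ : ∀ i, ∑ j, A i j = ρ)
    (V : Matrix (Fin n) (Fin r) ℝ) (hV : ∀ c, V *ᵥ c = 0 → c = 0)
    (W : Matrix (Fin r) (Fin r) ℝ) (hW : A * V = V * W) {s κ : ℝ}
    (hVs : ∀ j k, V (Fin.rev j) k = s * V j k)
    (hκ : (s = -1 ∧ κ = 0) ∨ (s = 1 ∧ κ = 1 ∧ ∃ c, V *ᵥ c = 1))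
    {t ε : ℝ} (ht : 0 ≤ t) (hε : |ε| = 1) :
    ∃ N : Matrix (Fin n) (Fin n) ℝ, IsNonnegative N ∧ IsCentrosymmetric N ∧
      N.charpoly * (X - C (ρ + κ * (ε * t))) * W.charpoly =
        A.charpoly * (X - C (ρ + κ * (ε * t) + r * t)) * (W + (ε * t) • 1).charpoly := by
  obtain ⟨i, hdet, hle⟩ := exists_rows_coordinates_le_one V hV
  have hs2 : s * s = 1 := by rcases hκ with ⟨rfl, -⟩ | ⟨rfl, -⟩ <;> norm_num
  have hs1 : |s| = 1 := by rcases hκ with ⟨rfl, -⟩ | ⟨rfl, -⟩ <;> simp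
  set G := V.submatrix i id with hG
  set S := reflectedSelection i s with hS
  set P := reflectedSelection i 1 with hP
  -- The columns of `V` have parity `s`, so averaging a row with `s` times its reflection reproduces
  -- that row.
  have hSV : S * V = G := by
    ext k l
    rw [hS, reflectedSelection_mul, hVs, hG]
    simp only [submatrix_apply, id]
    linear_combination V (i k) l / 2 * hs2
  have hYrev : ∀ j k, (V * G⁻¹) (Fin.rev j) k = s * (V * G⁻¹) j k := by
    intro j k
    simp only [Matrix.mul_apply, hVs, Finset.mul_sum, mul_assoc]
  set K : Matrix (Fin r) (Fin n) ℝ := (ε * t) • (G⁻¹ * S) with hK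
  have hKV : K * V = (ε * t) • 1 := by
    rw [hK, Matrix.smul_mul, Matrix.mul_assoc, hSV, nonsing_inv_mul _ hdet]
  have hVK : V * K = (ε * t) • (V * G⁻¹ * S) := by
    rw [hK, Matrix.mul_smul, Matrix.mul_assoc]
  -- Brauer's theorem needs constant row sums. In the skew case `S` annihilates `1`; in the
  -- symmetric case `1` lies in the column space of `V`, on which `V G⁻¹ S` is the identity.
  have hrow : ∀ j, ∑ l, (A + V * K) j l = ρ + κ * (ε * t) := by
    suffices h : ∀ j, ∑ l, (V * G⁻¹ * S) j l = κ by
      intro j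
      rw [hVK]
      simp only [Matrix.add_apply, Matrix.smul_apply, smul_eq_mul, Finset.sum_add_distrib, hρ,
        ← Finset.mul_sum, h]
      ring
    intro j
    have e : ∑ l, (V * G⁻¹ * S) j l = ((V * G⁻¹) *ᵥ (S *ᵥ 1)) j := by
      rw [mulVec_mulVec]; simp [mulVec, dotProduct]
    rw [e]
    rcases hκ with ⟨rfl, rfl⟩ | ⟨rfl, rfl, c, hc⟩
    · have : S *ᵥ 1 = 0 := by
        ext k; simp [mulVec, dotProduct, hS, reflectedSelection_row_sum]
      simp [this]
    · have : S *ᵥ 1 = G *ᵥ c := by rw [← hSV, ← mulVec_mulVec, hc]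
      rw [this, mulVec_mulVec, Matrix.mul_assoc, nonsing_inv_mul _ hdet, Matrix.mul_one, hc]
      rfl
  have hksum : ∑ j, t * ∑ k, P k j = r * t := by
    rw [← Finset.mul_sum, Finset.sum_comm]
    simp [hP, reflectedSelection_row_sum]
    ring
  -- The added constant rows dominate `|V K|` entrywise, because `|V G⁻¹| ≤ 1` and `|S| ≤ P`. The
  -- rows of `P` sum to one, so the added row has total `r t`.
  refine ⟨A + V * K + of fun _ j => t * ∑ k, P k j, fun j l => ?_, ?_, ?_⟩
  · rw [hVK]
    simp only [Matrix.add_apply, Matrix.smul_apply, smul_eq_mul, of_apply]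
    have h1 : |(V * G⁻¹ * S) j l| ≤ ∑ k, P k l := by
      rw [Matrix.mul_apply]
      refine (Finset.abs_sum_le_sum_abs _ _).trans (Finset.sum_le_sum fun k _ => ?_)
      rw [abs_mul]
      exact (mul_le_of_le_one_left (abs_nonneg _) (hle j k)).trans
        (abs_reflectedSelection_le i hs1 k l)
    have h2 : |ε * (V * G⁻¹ * S) j l| ≤ ∑ k, P k l := by rwa [abs_mul, hε, one_mul]
    have h3 := (abs_le.1 h2).1
    have h4 := hA j l
    nlinarith
  · rw [isCentrosymmetric_iff] at hcen ⊢
    intro j l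
    have h1 : (V * G⁻¹ * S) (Fin.rev j) (Fin.rev l) = (V * G⁻¹ * S) j l := by
      rw [Matrix.mul_apply, Matrix.mul_apply]
      refine Finset.sum_congr rfl fun k _ => ?_
      rw [hYrev, hS, reflectedSelection_rev i hs2]
      linear_combination (V * G⁻¹) j k * reflectedSelection i s k l * hs2
    have h2 : ∀ k, P k (Fin.rev l) = P k l := fun k => by
      rw [hP, reflectedSelection_rev i (one_mul (1 : ℝ)), one_mul]
    simp only [hVK, Matrix.add_apply, Matrix.smul_apply, smul_eq_mul, of_apply, hcen, h1, h2]
  · rw [charpoly_add_const_rows _ _ _ hrow, hksum]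
    have h := charpoly_add_mul_mul_charpoly A W V K hW
    rw [hKV] at h
    linear_combination (X - C (ρ + κ * (ε * t) + r * t)) * h

/-! ### Perron eigenvectors. -/

theorem mulVec_pos_of_pos {n : ℕ} {A : Matrix (Fin n) (Fin n) ℝ} (hA : ∀ i j, 0 < A i j)
    {x : Fin n → ℝ} (hx : ∀ i, 0 ≤ x i) (hne : x ≠ 0) (i : Fin n) : 0 < (A *ᵥ x) i := by
  obtain ⟨j, hj⟩ := Function.ne_iff.1 hne
  exact Finset.sum_pos' (fun k _ => mul_nonneg (hA i k).le (hx k))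
    ⟨j, Finset.mem_univ _, mul_pos (hA i j) ((hx j).lt_of_ne' hj)⟩

/-- Perron's theorem: a positive matrix has a positive eigenvector. -/
theorem exists_pos_eigenvector {n : ℕ} (hn : 0 < n) {A : Matrix (Fin n) (Fin n) ℝ}
    (hA : ∀ i j, 0 < A i j) :
    ∃ (r : ℝ) (w : Fin n → ℝ), (∀ i, 0 < w i) ∧ A *ᵥ w = r • w := by
  have : Nonempty (Fin n) := ⟨⟨0, hn⟩⟩
  let R := ∑ i, ∑ j, A i j
  -- Collatz–Wielandt: `r` is maximized subject to `r x ≤ A x` on the simplex. The bound `R` makes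
  -- the feasible set compact.
  let T : Set ((Fin n → ℝ) × ℝ) :=
    (stdSimplex ℝ (Fin n) ×ˢ Set.Icc 0 R) ∩ {p | ∀ i, p.2 * p.1 i ≤ (A *ᵥ p.1) i}
  have hbound : ∀ x ∈ stdSimplex ℝ (Fin n), ∀ r : ℝ, (∀ i, r * x i ≤ (A *ᵥ x) i) → r ≤ R := by
    intro x hx r h
    calc r = ∑ i, r * x i := by rw [← Finset.mul_sum, hx.2, mul_one]
      _ ≤ ∑ i, (A *ᵥ x) i := Finset.sum_le_sum fun i _ => h i
      _ ≤ R := Finset.sum_le_sum fun i _ => by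
          change ∑ j, A i j * x j ≤ ∑ j, A i j
          refine Finset.sum_le_sum fun j _ => mul_le_of_le_one_right (hA i j).le ?_
          exact hx.2 ▸ Finset.single_le_sum (fun k _ => hx.1 k) (Finset.mem_univ j)
  have hT : IsCompact T := by
    refine ((isCompact_stdSimplex ℝ (Fin n)).prod isCompact_Icc).inter_right ?_
    simp only [Set.ofPred_forall]
    refine isClosed_iInter fun i => isClosed_le (by fun_prop) ?_
    simp only [mulVec, dotProduct]
    fun_prop
  have hne : T.Nonempty := by
    obtain ⟨i⟩ := this
    refine ⟨(Pi.single i 1, 0), ⟨single_mem_stdSimplex ℝ i, le_rfl, ?_⟩, fun k => ?_⟩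
    · exact Finset.sum_nonneg fun i _ => Finset.sum_nonneg fun j _ => (hA i j).le
    · simpa using (hA k i).le
  obtain ⟨⟨x, r⟩, ⟨⟨hx, hr0, hrR⟩, hxr⟩, hmax⟩ :=
    hT.exists_isMaxOn hne (continuous_snd.continuousOn (s := T))
  simp only at hx hr0 hrR hxr
  have hx0 : x ≠ 0 := by rintro rfl; simpa using hx.2
  have hy := mulVec_pos_of_pos hA hx.1 hx0
  have heq : A *ᵥ x = r • x := by
    by_contra hcon
    -- If `A x ≠ r x`, then `y = A x` satisfies `A y > r y` in every coordinate, so `y` normalized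
    -- beats the maximum.
    have hz := mulVec_pos_of_pos hA (x := A *ᵥ x - r • x)
      (fun i => by simpa using hxr i) (sub_ne_zero.2 hcon)
    set y := A *ᵥ x with hydef
    have hlt : ∀ i, r < (A *ᵥ y) i / y i := fun i => by
      have := hz i
      rw [mulVec_sub, mulVec_smul, ← hydef] at this
      simp only [Pi.sub_apply, Pi.smul_apply, smul_eq_mul, sub_pos] at this
      rwa [lt_div_iff₀ (hy i)]
    obtain ⟨i₀, hi₀⟩ := Finite.exists_min fun i => (A *ᵥ y) i / y i
    set r' := (A *ᵥ y) i₀ / y i₀ with hr'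
    have hsum : 0 < ∑ i, y i := Finset.sum_pos (fun i _ => hy i) Finset.univ_nonempty
    have hmem : (∑ i, y i)⁻¹ • y ∈ stdSimplex ℝ (Fin n) := by
      refine ⟨fun i => mul_nonneg (inv_nonneg.2 hsum.le) (hy i).le, ?_⟩
      simp only [Pi.smul_apply, smul_eq_mul, ← Finset.mul_sum]
      exact inv_mul_cancel₀ hsum.ne'
    have hineq : ∀ i, r' * ((∑ i, y i)⁻¹ • y) i ≤ (A *ᵥ ((∑ i, y i)⁻¹ • y)) i := by
      intro i
      have := (le_div_iff₀ (hy i)).1 (hi₀ i)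
      rw [mulVec_smul]
      simp only [Pi.smul_apply, smul_eq_mul]
      rw [mul_left_comm]
      exact mul_le_mul_of_nonneg_left this (inv_nonneg.2 hsum.le)
    have hle : r' ≤ r := hmax (a := ((∑ i, y i)⁻¹ • y, r'))
      ⟨⟨hmem, hr0.trans (hlt i₀).le, hbound _ hmem _ hineq⟩, hineq⟩
    exact absurd (hlt i₀) hle.not_gt
  refine ⟨r, x, fun i => (hx.1 i).lt_of_ne' fun h => ?_, heq⟩
  have := hy i
  rw [heq] at this
  simp [h] at this

/-- Since `A` commutes with `J`, the vector `w + J w` is again an eigenvector. Its symmetry makes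
conjugation by its diagonal matrix preserve centrosymmetry. -/
theorem exists_pos_symmetric_eigenvector {n : ℕ} (hn : 0 < n) {A : Matrix (Fin n) (Fin n) ℝ}
    (hA : ∀ i j, 0 < A i j) (hcen : IsCentrosymmetric A) :
    ∃ (r : ℝ) (w : Fin n → ℝ), (∀ i, 0 < w i) ∧ (∀ i, w (Fin.rev i) = w i) ∧
      ∀ i, ∑ j, A i j * w j = r * w i := by
  obtain ⟨r, w, hw, h⟩ := exists_pos_eigenvector hn hA
  rw [isCentrosymmetric_iff] at hcen
  have h' : ∀ i, ∑ j, A i j * w j = r * w i := fun i => congrFun h i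
  refine ⟨r, fun i => w i + w (Fin.rev i), fun i => add_pos (hw _) (hw _),
    fun i => by simp only [Fin.rev_rev, add_comm], fun i => ?_⟩
  have h2 : ∑ j, A i j * w (Fin.rev j) = r * w (Fin.rev i) := by
    rw [← h', ← Equiv.sum_comp Fin.revPerm fun j => A (Fin.rev i) j * w j]
    simp only [Fin.revPerm_apply, hcen]
  simp only [mul_add, Finset.sum_add_distrib, h', h2]

/-! ### Reduction to constant row sums. -/

theorem charpoly_diagonal_conj {n : ℕ} (A : Matrix (Fin n) (Fin n) ℝ) {w : Fin n → ℝ}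
    (hw : ∀ i, w i ≠ 0) : (of fun i j => (w i)⁻¹ * A i j * w j).charpoly = A.charpoly := by
  have h : (of fun i j => (w i)⁻¹ * A i j * w j) =
      diagonal (fun i => (w i)⁻¹) * (A * diagonal w) := by
    ext i j; simp [mul_assoc]
  rw [h, charpoly_mul_comm, Matrix.mul_assoc, diagonal_mul_diagonal]
  simp [hw]

theorem skewSymmetricBlock_apply {n : ℕ} (A : Matrix (Fin n) (Fin n) ℝ) (i j : Fin (n / 2)) :
    skewSymmetricBlock A i j = A (Fin.castLE (Nat.div_le_self n 2) i)
      (Fin.castLE (Nat.div_le_self n 2) j) - A (Fin.rev (Fin.castLE (Nat.div_le_self n 2) i))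
      (Fin.castLE (Nat.div_le_self n 2) j) := by
  rw [skewSymmetricBlock, Matrix.sub_apply, counteridentity_mul]
  simp only [upperLeftBlock, lowerLeftBlock, of_apply]
  congr 2
  ext
  simp only [Fin.val_rev, Fin.val_castLE]
  omega

/-- Adding `ε` everywhere makes the matrix positive, and conjugating by a symmetric Perron vector
makes the row sums constant. The constant `ε` cancels in `A - JB`, so that block only undergoes a
diagonal conjugation. The entry bound does not depend on `ε`, which gives compactness as `ε → 0`. -/
theorem exists_const_row_sums_perturbed {n : ℕ} (hn : 0 < n) {A : Matrix (Fin n) (Fin n) ℝ}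
    (hA : IsNonnegative A) (hcen : IsCentrosymmetric A) {ε : ℝ} (hε : 0 < ε) (hε1 : ε ≤ 1) :
    ∃ N : Matrix (Fin n) (Fin n) ℝ, IsNonnegative N ∧ IsCentrosymmetric N ∧
      (∀ i i', ∑ j, N i j = ∑ j, N i' j) ∧ (∀ i j, N i j ≤ (∑ i, ∑ j, A i j) + n) ∧
      N.charpoly = (A + of fun _ _ => ε).charpoly ∧
      (skewSymmetricBlock N).charpoly = (skewSymmetricBlock A).charpoly := by
  have hcen' := isCentrosymmetric_iff.1 hcen
  set M : Matrix (Fin n) (Fin n) ℝ := A + of fun _ _ => ε with hM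
  have hMapp : ∀ i j, M i j = A i j + ε := fun i j => rfl
  have hMpos : ∀ i j, 0 < M i j := fun i j => add_pos_of_nonneg_of_pos (hA i j) hε
  have hMc : ∀ i j, M (Fin.rev i) (Fin.rev j) = M i j := fun i j => by simp [hMapp, hcen']
  obtain ⟨r, w, hw, hwrev, h⟩ := exists_pos_symmetric_eigenvector hn hMpos
    (isCentrosymmetric_iff.2 hMc)
  set N : Matrix (Fin n) (Fin n) ℝ := of fun i j => (w i)⁻¹ * M i j * w j with hN
  have hNapp : ∀ i j, N i j = (w i)⁻¹ * M i j * w j := fun i j => rfl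
  have hNpos : ∀ i j, 0 ≤ N i j := fun i j => by
    rw [hNapp]
    exact mul_nonneg (mul_nonneg (inv_nonneg.2 (hw i).le) (hMpos i j).le) (hw j).le
  have hrow : ∀ i, ∑ j, N i j = r := fun i => by
    simp only [hNapp, mul_assoc, ← Finset.mul_sum, h]
    field_simp [(hw i).ne']
  have hr : r ≤ (∑ i, ∑ j, A i j) + n := by
    have : Nonempty (Fin n) := ⟨⟨0, hn⟩⟩
    -- In the row where `w` is largest, conjugation does not increase any entry.
    obtain ⟨i, hi⟩ := Finite.exists_max w
    calc r = ∑ j, N i j := (hrow i).symm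
      _ ≤ ∑ j, (A i j + 1) := Finset.sum_le_sum fun j _ => by
          have h1 : w j / w i ≤ 1 := (div_le_one (hw i)).2 (hi j)
          have h2 : N i j = M i j * (w j / w i) := by rw [hNapp]; ring
          rw [h2]
          refine (mul_le_of_le_one_right (hMpos i j).le h1).trans ?_
          rw [hMapp]; linarith
      _ = (∑ j, A i j) + n := by simp [Finset.sum_add_distrib]
      _ ≤ _ := by
          refine add_le_add_left ?_ _
          exact Finset.single_le_sum (f := fun i => ∑ j, A i j)
            (fun k _ => Finset.sum_nonneg fun j _ => hA k j) (Finset.mem_univ i)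
  refine ⟨N, hNpos, ?_, fun i i' => by rw [hrow, hrow], fun i j => ?_,
    charpoly_diagonal_conj M fun i => (hw i).ne', ?_⟩
  · rw [isCentrosymmetric_iff]
    intro i j
    simp [hNapp, hwrev, hMc]
  · exact (Finset.single_le_sum (fun k _ => hNpos i k) (Finset.mem_univ j)).trans
      ((hrow i).le.trans hr)
  · rw [← charpoly_diagonal_conj (skewSymmetricBlock A)
      (w := fun i => w (Fin.castLE (Nat.div_le_self n 2) i)) fun i => (hw _).ne']
    congr 1
    ext i j
    simp only [skewSymmetricBlock_apply, hNapp, hMapp, hwrev, of_apply]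
    ring

theorem continuous_eval_charpoly {m : ℕ} (x : ℝ) :
    Continuous fun M : Matrix (Fin m) (Fin m) ℝ => M.charpoly.eval x := by
  simp only [eval_charpoly]
  fun_prop

/-- A nonnegative centrosymmetric matrix is cospectral to one with constant row sums, and the
skew-symmetric blocks are cospectral, too. -/
theorem exists_cospectral_const_row_sums {n : ℕ} (hn : 0 < n) {A : Matrix (Fin n) (Fin n) ℝ}
    (hA : IsNonnegative A) (hcen : IsCentrosymmetric A) :
    ∃ (N : Matrix (Fin n) (Fin n) ℝ) (ρ : ℝ), IsNonnegative N ∧ IsCentrosymmetric N ∧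
      (∀ i, ∑ j, N i j = ρ) ∧ N.charpoly = A.charpoly ∧
      (skewSymmetricBlock N).charpoly = (skewSymmetricBlock A).charpoly := by
  choose F hF0 hFc hFr hFb hFp hFs using fun k : ℕ =>
    exists_const_row_sums_perturbed hn hA hcen (ε := 1 / ((k : ℝ) + 1)) (by positivity)
      (by rw [div_le_one (by positivity)]; linarith [(Nat.cast_nonneg k : (0 : ℝ) ≤ k)])
  -- The conjugating vectors may degenerate as `ε → 0`, but the conjugated matrices stay in a
  -- compact box, so a subsequence converges.
  obtain ⟨N, hN, φ, hφ, hlim⟩ := IsCompact.tendsto_subseq (X := Fin n → Fin n → ℝ)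
    (isCompact_Icc (a := 0) (b := fun _ _ => (∑ i, ∑ j, A i j) + n)) (x := F)
    fun k => ⟨fun i j => hF0 k i j, fun i j => hFb k i j⟩
  change Filter.Tendsto (fun k => F (φ k)) _ (nhds (of N)) at hlim
  have hent : ∀ i j, Filter.Tendsto (fun k => F (φ k) i j) Filter.atTop (nhds (N i j)) :=
    fun i j => tendsto_pi_nhds.1 (tendsto_pi_nhds.1 hlim i) j
  have hcN : ∀ i j, N (Fin.rev i) (Fin.rev j) = N i j := fun i j =>
    tendsto_nhds_unique (hent _ _) ((hent i j).congr fun k =>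
      (isCentrosymmetric_iff.1 (hFc (φ k)) i j).symm)
  have hsum : ∀ i, Filter.Tendsto (fun k => ∑ j, F (φ k) i j) Filter.atTop
      (nhds (∑ j, N i j)) := fun i => tendsto_finsetSum _ fun j _ => hent i j
  refine ⟨of N, ∑ j, N ⟨0, hn⟩ j, fun i j => hN.1 i j, isCentrosymmetric_iff.2 hcN, fun i =>
    tendsto_nhds_unique (hsum i) ((hsum ⟨0, hn⟩).congr fun k => hFr (φ k) _ _), ?_, ?_⟩
  · refine Polynomial.funext fun x => ?_
    have h1 := ((continuous_eval_charpoly x).tendsto _).comp hlim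
    have h2 : Filter.Tendsto (fun k => A + of fun _ _ : Fin n => 1 / ((φ k : ℝ) + 1))
        Filter.atTop (nhds A) := by
      refine tendsto_pi_nhds.2 fun i => tendsto_pi_nhds.2 fun j => ?_
      have := (tendsto_one_div_add_atTop_nhds_zero_nat (𝕜 := ℝ)).comp hφ.tendsto_atTop
      simpa using this.const_add (A i j)
    have h3 := ((continuous_eval_charpoly x).tendsto _).comp h2
    refine tendsto_nhds_unique h1 (h3.congr fun k => ?_)
    simp only [Function.comp_apply]
    rw [hFp]
  · refine Polynomial.funext fun x => ?_
    have h1 : Filter.Tendsto (fun k => skewSymmetricBlock (F (φ k))) Filter.atTop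
        (nhds (skewSymmetricBlock (of N))) := by
      refine tendsto_pi_nhds.2 fun i => tendsto_pi_nhds.2 fun j => ?_
      simp only [skewSymmetricBlock_apply]
      exact (hent _ _).sub (hent _ _)
    have h2 := ((continuous_eval_charpoly x).tendsto _).comp h1
    refine tendsto_nhds_unique h2 (tendsto_const_nhds.congr fun k => ?_)
    simp only [Function.comp_apply]
    rw [hFs]

/-! ### Eigenvectors, parity and the block `A - JB`. -/

theorem mem_eigenvalueList_iff {n : ℕ} {A : Matrix (Fin n) (Fin n) ℝ} {z : ℂ} :
    z ∈ eigenvalueList A ↔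
      ∃ x : Fin n → ℂ, x ≠ 0 ∧ ∀ i, ∑ j, (A i j : ℂ) * x j = z * x i := by
  rw [eigenvalueList, mem_roots (charpoly_monic _).ne_zero, IsRoot.def, eval_charpoly,
    ← exists_mulVec_eq_zero_iff]
  refine exists_congr fun x => and_congr_right fun _ => ?_
  rw [sub_mulVec, sub_eq_zero, funext_iff]
  refine forall_congr' fun i => ?_
  rw [eq_comm]
  simp [mulVec, dotProduct, scalar_apply, diagonal_apply]

theorem exists_symmetric_or_skew_eigenvector {n : ℕ} {A : Matrix (Fin n) (Fin n) ℝ}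
    (hcen : IsCentrosymmetric A) {z : ℂ} (hz : z ∈ eigenvalueList A) :
    ∃ s : ℝ, (s = 1 ∨ s = -1) ∧ ∃ x : Fin n → ℂ, x ≠ 0 ∧ (∀ i, x (Fin.rev i) = s * x i) ∧
      ∀ i, ∑ j, (A i j : ℂ) * x j = z * x i := by
  rw [isCentrosymmetric_iff] at hcen
  obtain ⟨x, hx, h⟩ := mem_eigenvalueList_iff.1 hz
  have hr : ∀ i, ∑ j, (A i j : ℂ) * x (Fin.rev j) = z * x (Fin.rev i) := fun i => by
    rw [← h, ← Equiv.sum_comp Fin.revPerm fun j => (A (Fin.rev i) j : ℂ) * x j]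
    simp only [Fin.revPerm_apply, hcen]
  by_cases hs : (fun i => x i + x (Fin.rev i)) = 0
  -- If the symmetric part `x + J x` vanishes, `x` is skew; otherwise that part is itself an
  -- eigenvector.
  · have hs' : ∀ i, x i + x (Fin.rev i) = 0 := fun i => congrFun hs i
    exact ⟨-1, Or.inr rfl, x, hx, fun i => by push_cast; linear_combination hs' i, h⟩
  · refine ⟨1, Or.inl rfl, _, hs, fun i => ?_, fun i => ?_⟩
    · simp only [Fin.rev_rev]; push_cast; ring
    · simp only [mul_add, Finset.sum_add_distrib, h, hr]

/-- The embedding of the first half of the indices. -/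
def firstHalf (n : ℕ) (i : Fin (n / 2)) : Fin n := Fin.castLE (Nat.div_le_self n 2) i

theorem sum_eq_sum_firstHalf {n : ℕ} {f : Fin n → ℂ} (hf : ∀ i, Fin.rev i = i → f i = 0) :
    ∑ i, f i = ∑ i, (f (firstHalf n i) + f (Fin.rev (firstHalf n i))) := by
  have h1 : ∀ i, f i = (if i < Fin.rev i then f i else 0) +
      (if Fin.rev i < i then f i else 0) := fun i => by
    rcases lt_trichotomy i (Fin.rev i) with h | h | h
    · simp [h, h.not_gt]
    · simp [← h, hf i h.symm]
    · simp [h, h.not_gt]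
  have h2 : ∑ i : Fin n, (if Fin.rev i < i then f i else 0) =
      ∑ i : Fin n, (if i < Fin.rev i then f (Fin.rev i) else 0) := by
    rw [← Equiv.sum_comp Fin.revPerm]
    simp
  rw [Finset.sum_congr rfl fun i _ => h1 i, Finset.sum_add_distrib, h2, ← Finset.sum_filter,
    ← Finset.sum_filter, ← Finset.sum_add_distrib]
  have h3 : Finset.univ.filter (fun i : Fin n => i < Fin.rev i) =
      Finset.univ.map (Fin.castLEEmb (Nat.div_le_self n 2)) := by
    ext i
    simp only [Finset.mem_filter, Finset.mem_univ, true_and, Finset.mem_map, Fin.lt_def,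
      Fin.val_rev]
    constructor
    · intro h
      exact ⟨⟨i, by omega⟩, Fin.ext rfl⟩
    · rintro ⟨j, rfl⟩
      simp only [Fin.castLEEmb_apply, Fin.val_castLE]
      omega
  rw [h3, Finset.sum_map]
  rfl

theorem sum_mul_skew {n : ℕ} {A : Matrix (Fin n) (Fin n) ℝ} (hcen : IsCentrosymmetric A)
    {x : Fin n → ℂ} (hx : ∀ i, x (Fin.rev i) = -x i) (i : Fin n) :
    ∑ j, (A i j : ℂ) * x j = ∑ j, ((A i (firstHalf n j) : ℂ) - A (Fin.rev i) (firstHalf n j)) *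
      x (firstHalf n j) := by
  rw [isCentrosymmetric_iff] at hcen
  rw [sum_eq_sum_firstHalf fun j hj => ?_]
  · refine Finset.sum_congr rfl fun j _ => ?_
    rw [← hcen i (Fin.rev _), Fin.rev_rev, hx]
    ring
  · have h := hx j
    rw [hj] at h
    rw [self_eq_neg.1 h, mul_zero]

/-- A skew vector is determined by its first half, its middle coordinate being zero for odd `n`. On
first halves, `A` acts as the skew block by `sum_mul_skew`. -/
theorem mem_eigenvalueList_skewSymmetricBlock_iff {n : ℕ} {A : Matrix (Fin n) (Fin n) ℝ}
    (hcen : IsCentrosymmetric A) {z : ℂ} :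
    z ∈ eigenvalueList (skewSymmetricBlock A) ↔ ∃ x : Fin n → ℂ, x ≠ 0 ∧
      (∀ i, x (Fin.rev i) = -x i) ∧ ∀ i, ∑ j, (A i j : ℂ) * x j = z * x i := by
  rw [mem_eigenvalueList_iff]
  constructor
  · rintro ⟨w, hw, h⟩
    let x : Fin n → ℂ := fun i => if hi : (i : ℕ) < n / 2 then w ⟨i, hi⟩ else
      if hi : (Fin.rev i : ℕ) < n / 2 then -w ⟨Fin.rev i, hi⟩ else 0
    have hxw : ∀ j, x (firstHalf n j) = w j := fun j => dif_pos j.2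
    have hx : ∀ i, x (Fin.rev i) = -x i := fun i => by
      by_cases h1 : (i : ℕ) < n / 2
      · have h2 : ¬ (Fin.rev i : ℕ) < n / 2 := by rw [Fin.val_rev]; omega
        simp only [x, Fin.rev_rev, h1, h2, dif_pos, dif_neg, not_false_eq_true]
      · by_cases h2 : (Fin.rev i : ℕ) < n / 2
        · simp only [x, h1, h2, dif_pos, dif_neg, not_false_eq_true, neg_neg]
        · simp only [x, Fin.rev_rev, h1, h2, dif_neg, not_false_eq_true, neg_zero]
    have hkey : ∀ i, ∑ j, (A (firstHalf n i) j : ℂ) * x j = z * x (firstHalf n i) := fun i => by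
      rw [sum_mul_skew hcen hx, hxw, ← h i]
      refine Finset.sum_congr rfl fun j _ => ?_
      rw [hxw, skewSymmetricBlock_apply]
      push_cast
      rfl
    have hneg : ∀ i, ∑ j, (A (Fin.rev i) j : ℂ) * x j = -∑ j, (A i j : ℂ) * x j := fun i => by
      rw [sum_mul_skew hcen hx, sum_mul_skew hcen hx, Fin.rev_rev, ← Finset.sum_neg_distrib]
      exact Finset.sum_congr rfl fun j _ => by ring
    refine ⟨x, fun h0 => hw ?_, hx, fun i => ?_⟩
    · ext j
      rw [← hxw, h0]; rfl
    · by_cases h1 : (i : ℕ) < n / 2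
      · exact hkey ⟨i, h1⟩
      · by_cases h2 : (Fin.rev i : ℕ) < n / 2
        · have h3 := hkey ⟨Fin.rev i, h2⟩
          have h4 : firstHalf n ⟨Fin.rev i, h2⟩ = Fin.rev i := rfl
          rw [h4, hneg, hx] at h3
          linear_combination -h3
        · have h3 : Fin.rev i = i := by
            ext
            rw [Fin.val_rev] at h2 ⊢
            omega
          have h4 := hneg i
          rw [h3] at h4
          have h5 := hx i
          rw [h3] at h5
          rw [self_eq_neg.1 h4, self_eq_neg.1 h5, mul_zero]
  · rintro ⟨x, hx0, hx, h⟩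
    refine ⟨fun j => x (firstHalf n j), fun h0 => hx0 ?_, fun i => ?_⟩
    · have h0' : ∀ j, x (firstHalf n j) = 0 := fun j => congrFun h0 j
      ext i
      by_cases h1 : (i : ℕ) < n / 2
      · exact h0' ⟨i, h1⟩
      · by_cases h2 : (Fin.rev i : ℕ) < n / 2
        · have h3 : x (Fin.rev i) = 0 := h0' ⟨Fin.rev i, h2⟩
          rw [hx, neg_eq_zero] at h3
          exact h3
        · have h3 : Fin.rev i = i := by
            ext
            rw [Fin.val_rev] at h2 ⊢
            omega
          have h5 := hx i
          rw [h3] at h5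
          exact self_eq_neg.1 h5
    · rw [← h, sum_mul_skew hcen hx]
      refine Finset.sum_congr rfl fun j _ => ?_
      rw [skewSymmetricBlock_apply]
      push_cast
      rfl

theorem conj_mem_eigenvalueList {n : ℕ} {A : Matrix (Fin n) (Fin n) ℝ} {z : ℂ}
    (hz : z ∈ eigenvalueList A) : (starRingEnd ℂ) z ∈ eigenvalueList A := by
  obtain ⟨x, hx, h⟩ := mem_eigenvalueList_iff.1 hz
  refine mem_eigenvalueList_iff.2 ⟨fun i => (starRingEnd ℂ) (x i), fun h0 => hx ?_, fun i => ?_⟩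
  · ext i
    simpa using congrFun h0 i
  · have := congrArg (starRingEnd ℂ) (h i)
    simpa using this

/-- An eigenvalue of a nonnegative matrix is bounded by the constant row sum. -/
theorem norm_le_of_const_row_sums {n : ℕ} {A : Matrix (Fin n) (Fin n) ℝ} (hA : IsNonnegative A)
    {ρ : ℝ} (hρ : ∀ i, ∑ j, A i j = ρ) {z : ℂ} (hz : z ∈ eigenvalueList A) : ‖z‖ ≤ ρ := by
  obtain ⟨x, hx, h⟩ := mem_eigenvalueList_iff.1 hz
  obtain ⟨k, hk⟩ := Function.ne_iff.1 hx
  have : Nonempty (Fin n) := ⟨k⟩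
  obtain ⟨i, hi⟩ := Finite.exists_max fun i => ‖x i‖
  have hpos : 0 < ‖x i‖ := (norm_pos_iff.2 hk).trans_le (hi k)
  refine le_of_mul_le_mul_right ?_ hpos
  rw [← norm_mul, ← h, ← hρ i, Finset.sum_mul]
  refine (norm_sum_le _ _).trans (Finset.sum_le_sum fun j _ => ?_)
  rw [norm_mul, Complex.norm_real, Real.norm_of_nonneg (hA i j)]
  exact mul_le_mul_of_nonneg_left (hi j) (hA i j)

theorem const_row_sum_mem_eigenvalueList {n : ℕ} (hn : 0 < n) {A : Matrix (Fin n) (Fin n) ℝ}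
    {ρ : ℝ} (hρ : ∀ i, ∑ j, A i j = ρ) : (ρ : ℂ) ∈ eigenvalueList A := by
  refine mem_eigenvalueList_iff.2 ⟨1, fun h => ?_, fun i => ?_⟩
  · exact one_ne_zero (congrFun h ⟨0, hn⟩)
  · simp [← hρ i]

/-! ### Shifting a conjugate pair. -/

/-- The real quadratic polynomial with roots `a ± b i`. -/
noncomputable def conjPairPoly (a b : ℝ) : ℝ[X] := (X - C a) ^ 2 + C (b ^ 2)

theorem eigenvector_re_im {n : ℕ} {A : Matrix (Fin n) (Fin n) ℝ} {a b : ℝ} {x : Fin n → ℂ}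
    (h : ∀ i, ∑ j, (A i j : ℂ) * x j = ((a : ℂ) + b * Complex.I) * x i) (i : Fin n) :
    ∑ j, A i j * (x j).re = a * (x i).re - b * (x i).im ∧
      ∑ j, A i j * (x j).im = b * (x i).re + a * (x i).im := by
  constructor
  · simpa using congrArg Complex.re (h i)
  · have := congrArg Complex.im (h i)
    simp at this
    rw [this]; ring

theorem re_im_linearIndependent {n : ℕ} {A : Matrix (Fin n) (Fin n) ℝ} {a b : ℝ} (hb : b ≠ 0)
    {x : Fin n → ℂ} (hx : x ≠ 0)
    (h : ∀ i, ∑ j, (A i j : ℂ) * x j = ((a : ℂ) + b * Complex.I) * x i) {α β : ℝ}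
    (h0 : ∀ i, α * (x i).re + β * (x i).im = 0) : α = 0 ∧ β = 0 := by
  -- Applying `A` to the relation and subtracting `a` times it leaves `b` times a second relation.
  -- The two together have determinant `-(α² + β²)`.
  have h1 : ∀ i, β * (x i).re - α * (x i).im = 0 := fun i => by
    obtain ⟨hr, hi⟩ := eigenvector_re_im h i
    have h2 : ∑ j, A i j * (α * (x j).re + β * (x j).im) = 0 := by simp [h0]
    have h3 : ∑ j, A i j * (α * (x j).re + β * (x j).im) =
        α * ∑ j, A i j * (x j).re + β * ∑ j, A i j * (x j).im := by
      rw [Finset.mul_sum, Finset.mul_sum, ← Finset.sum_add_distrib]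
      exact Finset.sum_congr rfl fun j _ => by ring
    rw [h3, hr, hi] at h2
    have h4 : b * (β * (x i).re - α * (x i).im) = 0 := by linear_combination h2 - a * h0 i
    exact (mul_eq_zero.1 h4).resolve_left hb
  obtain ⟨k, hk⟩ := Function.ne_iff.1 hx
  by_contra hne
  have hpos : α ^ 2 + β ^ 2 ≠ 0 := fun hz => hne
    ⟨by nlinarith [sq_nonneg α, sq_nonneg β], by nlinarith [sq_nonneg α, sq_nonneg β]⟩
  refine hk (Complex.ext ?_ ?_)
  · refine (mul_eq_zero.1 (?_ : (α ^ 2 + β ^ 2) * (x k).re = 0)).resolve_left hpos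
    linear_combination α * h0 k + β * h1 k
  · refine (mul_eq_zero.1 (?_ : (α ^ 2 + β ^ 2) * (x k).im = 0)).resolve_left hpos
    linear_combination β * h0 k - α * h1 k

theorem charpoly_conjPair (a b : ℝ) :
    (!![a, b; -b, a] : Matrix (Fin 2) (Fin 2) ℝ).charpoly = conjPairPoly a b := by
  rw [charpoly_fin_two, conjPairPoly, trace_fin_two_of, det_fin_two_of]
  simp only [map_add, map_sub, map_mul, map_neg, map_pow]
  ring

theorem charpoly_conjPair_cons (ρ a b : ℝ) :
    (!![ρ, 0, 0; 0, a, b; 0, -b, a] : Matrix (Fin 3) (Fin 3) ℝ).charpoly =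
      (X - C ρ) * conjPairPoly a b := by
  rw [charpoly, det_fin_three, conjPairPoly]
  simp
  ring

theorem exists_shift_of_skew_eigenvector {n : ℕ} {A : Matrix (Fin n) (Fin n) ℝ}
    (hA : IsNonnegative A) (hcen : IsCentrosymmetric A) {ρ : ℝ} (hρ : ∀ i, ∑ j, A i j = ρ)
    {a b : ℝ} (hb : b ≠ 0) {x : Fin n → ℂ} (hx : x ≠ 0) (hxs : ∀ i, x (Fin.rev i) = -x i)
    (h : ∀ i, ∑ j, (A i j : ℂ) * x j = ((a : ℂ) + b * Complex.I) * x i)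
    {t ε : ℝ} (ht : 0 ≤ t) (hε : |ε| = 1) :
    ∃ N : Matrix (Fin n) (Fin n) ℝ, IsNonnegative N ∧ IsCentrosymmetric N ∧
      N.charpoly * (X - C ρ) * conjPairPoly a b =
        A.charpoly * (X - C (ρ + 2 * t)) * conjPairPoly (a + ε * t) b := by
  let V : Matrix (Fin n) (Fin 2) ℝ := of fun i => ![(x i).re, (x i).im]
  have hV : ∀ c, V *ᵥ c = 0 → c = 0 := by
    intro c hc
    have h0 : ∀ i, c 0 * (x i).re + c 1 * (x i).im = 0 := fun i => by
      have := congrFun hc i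
      simp [V, mulVec, dotProduct, Fin.sum_univ_two] at this
      linear_combination this
    obtain ⟨h1, h2⟩ := re_im_linearIndependent hb hx h h0
    ext k; fin_cases k <;> simp [h1, h2]
  have hW : A * V = V * !![a, b; -b, a] := by
    ext i k
    obtain ⟨hr, hi⟩ := eigenvector_re_im h i
    fin_cases k
    · simp [V, Matrix.mul_apply, Fin.sum_univ_two, hr]; ring
    · simp [V, Matrix.mul_apply, Fin.sum_univ_two, hi]; ring
  have hVs : ∀ j k, V (Fin.rev j) k = -1 * V j k := by
    intro i k
    fin_cases k <;> simp [V, hxs]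
  obtain ⟨N, hN, hNc, hNp⟩ := exists_perturbation hA hcen hρ V hV _ hW hVs
    (Or.inl ⟨rfl, rfl⟩) ht hε
  refine ⟨N, hN, hNc, ?_⟩
  have e : (!![a, b; -b, a] : Matrix (Fin 2) (Fin 2) ℝ) + (ε * t) • 1 =
      !![a + ε * t, b; -b, a + ε * t] := by
    ext i j; fin_cases i <;> fin_cases j <;> simp
  simpa [e, charpoly_conjPair] using hNp

/-- The vector `1` joins the subspace to keep the row sums constant after the perturbation. The
price is a third column and a shift of `ρ` by `ε t`. -/
theorem exists_shift_of_symmetric_eigenvector {n : ℕ} {A : Matrix (Fin n) (Fin n) ℝ}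
    (hA : IsNonnegative A) (hcen : IsCentrosymmetric A) {ρ : ℝ} (hρ : ∀ i, ∑ j, A i j = ρ)
    {a b : ℝ} (hb : b ≠ 0) {x : Fin n → ℂ} (hx : x ≠ 0) (hxs : ∀ i, x (Fin.rev i) = x i)
    (h : ∀ i, ∑ j, (A i j : ℂ) * x j = ((a : ℂ) + b * Complex.I) * x i)
    {t ε : ℝ} (ht : 0 ≤ t) (hε : |ε| = 1) :
    ∃ N : Matrix (Fin n) (Fin n) ℝ, IsNonnegative N ∧ IsCentrosymmetric N ∧
      N.charpoly * (X - C ρ) * conjPairPoly a b =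
        A.charpoly * (X - C (ρ + ε * t + 3 * t)) * conjPairPoly (a + ε * t) b := by
  let V : Matrix (Fin n) (Fin 3) ℝ := of fun i => ![1, (x i).re, (x i).im]
  have hV : ∀ c, V *ᵥ c = 0 → c = 0 := by
    intro c hc
    have h0 : ∀ i, c 0 + c 1 * (x i).re + c 2 * (x i).im = 0 := fun i => by
      have := congrFun hc i
      simp [V, mulVec, dotProduct, Fin.sum_univ_three] at this
      linear_combination this
    -- Applying `A - ρ` removes the constant term. The resulting system for `c 1, c 2` has
    -- determinant `(a - ρ)² + b²` up to sign, nonzero since `b ≠ 0`.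
    have h3 : ∀ i, (c 1 * (a - ρ) + c 2 * b) * (x i).re +
        (c 2 * (a - ρ) - c 1 * b) * (x i).im = 0 := fun i => by
      obtain ⟨hr, hi⟩ := eigenvector_re_im h i
      have h4 : ∑ j, A i j * (c 0 + c 1 * (x j).re + c 2 * (x j).im) = 0 := by simp [h0]
      have h5 : ∑ j, A i j * (c 0 + c 1 * (x j).re + c 2 * (x j).im) =
          c 0 * ∑ j, A i j + c 1 * ∑ j, A i j * (x j).re + c 2 * ∑ j, A i j * (x j).im := by
        rw [Finset.mul_sum, Finset.mul_sum, Finset.mul_sum, ← Finset.sum_add_distrib,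
          ← Finset.sum_add_distrib]
        exact Finset.sum_congr rfl fun j _ => by ring
      rw [h5, hr, hi, hρ] at h4
      linear_combination h4 - ρ * h0 i
    obtain ⟨h1, h2⟩ := re_im_linearIndependent hb hx h h3
    have hD : (a - ρ) ^ 2 + b ^ 2 ≠ 0 := by positivity
    have hc1 : c 1 = 0 := by
      refine (mul_eq_zero.1 (?_ : ((a - ρ) ^ 2 + b ^ 2) * c 1 = 0)).resolve_left hD
      linear_combination (a - ρ) * h1 - b * h2
    have hc2 : c 2 = 0 := by
      refine (mul_eq_zero.1 (?_ : ((a - ρ) ^ 2 + b ^ 2) * c 2 = 0)).resolve_left hD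
      linear_combination b * h1 + (a - ρ) * h2
    obtain ⟨k, -⟩ := Function.ne_iff.1 hx
    have hc0 : c 0 = 0 := by simpa [hc1, hc2] using h0 k
    ext k; fin_cases k <;> simp [hc0, hc1, hc2]
  have hW : A * V = V * !![ρ, 0, 0; 0, a, b; 0, -b, a] := by
    ext i k
    obtain ⟨hr, hi⟩ := eigenvector_re_im h i
    fin_cases k
    · simp [V, Matrix.mul_apply, Fin.sum_univ_three, hρ]
    · simp [V, Matrix.mul_apply, Fin.sum_univ_three, hr]; ring
    · simp [V, Matrix.mul_apply, Fin.sum_univ_three, hi]; ring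
  have hVs : ∀ j k, V (Fin.rev j) k = 1 * V j k := by
    intro i k
    fin_cases k <;> simp [V, hxs]
  have hV1 : V *ᵥ ![1, 0, 0] = 1 := by
    ext i
    simp [V, mulVec, dotProduct, Fin.sum_univ_three]
  obtain ⟨N, hN, hNc, hNp⟩ := exists_perturbation hA hcen hρ V hV _ hW hVs
    (Or.inr ⟨rfl, rfl, _, hV1⟩) ht hε
  refine ⟨N, hN, hNc, ?_⟩
  have e : (!![ρ, 0, 0; 0, a, b; 0, -b, a] : Matrix (Fin 3) (Fin 3) ℝ) + (ε * t) • 1 =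
      !![ρ + ε * t, 0, 0; 0, a + ε * t, b; 0, -b, a + ε * t] := by
    ext i j; fin_cases i <;> fin_cases j <;> simp
  rw [e, charpoly_conjPair_cons, charpoly_conjPair_cons, one_mul, Nat.cast_ofNat] at hNp
  -- The intermediate row sum `ρ + ε t` occurs both in Brauer's step and as an eigenvalue of the
  -- shifted `W`, so its factor cancels.
  refine mul_left_cancel₀ (X_sub_C_ne_zero (ρ + ε * t)) ?_
  linear_combination hNp

/-! ### From characteristic polynomials to spectra, and conclusion. -/

theorem eigenvalueList_eq_roots_map {n : ℕ} (A : Matrix (Fin n) (Fin n) ℝ) :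
    eigenvalueList A = (A.charpoly.map Complex.ofRealHom).roots := by
  rw [← charpoly_map]; rfl

theorem map_charpoly_eq_prod {n : ℕ} (A : Matrix (Fin n) (Fin n) ℝ) :
    A.charpoly.map Complex.ofRealHom = ((eigenvalueList A).map fun z => X - C z).prod := by
  rw [eigenvalueList_eq_roots_map]
  exact (IsAlgClosed.splits _).eq_prod_roots_of_monic ((charpoly_monic A).map _)

theorem map_conjPairPoly (a b : ℝ) : (conjPairPoly a b).map Complex.ofRealHom =
    (X - C ((a : ℂ) + b * Complex.I)) * (X - C ((a : ℂ) - b * Complex.I)) := by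
  have h : (C Complex.I : ℂ[X]) ^ 2 = -1 := by rw [← C_pow, Complex.I_sq]; simp
  simp [conjPairPoly]
  linear_combination C (b : ℂ) ^ 2 * (h : (C Complex.I : ℂ[X]) ^ 2 = -1)

theorem eigenvalueList_of_charpoly_eq {n : ℕ} {A N : Matrix (Fin n) (Fin n) ℝ}
    {ρ ρ' a a' b : ℝ} {L : Multiset ℂ}
    (hspec : eigenvalueList A =
      (ρ : ℂ) ::ₘ ((a : ℂ) + b * Complex.I) ::ₘ ((a : ℂ) - b * Complex.I) ::ₘ L)
    (h : N.charpoly * (X - C ρ) * conjPairPoly a b =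
      A.charpoly * (X - C ρ') * conjPairPoly a' b) :
    eigenvalueList N =
      (ρ' : ℂ) ::ₘ ((a' : ℂ) + b * Complex.I) ::ₘ ((a' : ℂ) - b * Complex.I) ::ₘ L := by
  have h1 := congrArg (Polynomial.map Complex.ofRealHom) h
  simp only [Polynomial.map_mul, map_conjPairPoly, Polynomial.map_sub, map_X, map_C,
    map_charpoly_eq_prod A, hspec, Multiset.map_cons, Multiset.prod_cons,
    Complex.ofRealHom_eq_coe] at h1
  have h2 : N.charpoly.map Complex.ofRealHom =
      (((ρ' : ℂ) ::ₘ ((a' : ℂ) + b * Complex.I) ::ₘ ((a' : ℂ) - b * Complex.I) ::ₘ L).map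
        fun z => X - C z).prod := by
    simp only [Multiset.map_cons, Multiset.prod_cons]
    refine mul_right_cancel₀ (mul_ne_zero (X_sub_C_ne_zero (ρ : ℂ)) (mul_ne_zero
      (X_sub_C_ne_zero ((a : ℂ) + b * Complex.I)) (X_sub_C_ne_zero ((a : ℂ) - b * Complex.I)))) ?_
    linear_combination h1
  rw [eigenvalueList_eq_roots_map, h2, roots_multiset_prod_X_sub_C]

theorem eigenvalueList_congr {n : ℕ} {A B : Matrix (Fin n) (Fin n) ℝ}
    (h : A.charpoly = B.charpoly) : eigenvalueList A = eigenvalueList B := by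
  rw [eigenvalueList_eq_roots_map, eigenvalueList_eq_roots_map, h]

theorem theorem4p3 (n : ℕ) (C : Matrix (Fin n) (Fin n) ℝ)
    (hnonneg : IsNonnegative C) (hcentro : IsCentrosymmetric C)
    (l₁ a b : ℝ) (hb : 0 < b) (L : Multiset ℂ)
    (hspec : eigenvalueList C =
      (l₁ : ℂ) ::ₘ ((a : ℂ) + b * Complex.I) ::ₘ ((a : ℂ) - b * Complex.I) ::ₘ L)
    (hperron : ∀ z ∈ eigenvalueList C, ‖z‖ ≤ l₁)
    (t : ℝ) (ht : 0 ≤ t) :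
    ((l₁ + 2 * t : ℝ) : ℂ) ::ₘ (((a - t : ℝ) : ℂ) + b * Complex.I) ::ₘ
        (((a - t : ℝ) : ℂ) - b * Complex.I) ::ₘ L ∈ centrosymmetricallyRealizable n ∧
    (((a : ℂ) + b * Complex.I ∈ eigenvalueList (skewSymmetricBlock C) ∧
        (a : ℂ) - b * Complex.I ∈ eigenvalueList (skewSymmetricBlock C)) →
      ((l₁ + 2 * t : ℝ) : ℂ) ::ₘ (((a + t : ℝ) : ℂ) + b * Complex.I) ::ₘ
        (((a + t : ℝ) : ℂ) - b * Complex.I) ::ₘ L ∈ centrosymmetricallyRealizable n) ∧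
    (¬ ((a : ℂ) + b * Complex.I ∈ eigenvalueList (skewSymmetricBlock C) ∧
        (a : ℂ) - b * Complex.I ∈ eigenvalueList (skewSymmetricBlock C)) →
      ((l₁ + 4 * t : ℝ) : ℂ) ::ₘ (((a + t : ℝ) : ℂ) + b * Complex.I) ::ₘ
        (((a + t : ℝ) : ℂ) - b * Complex.I) ::ₘ L ∈ centrosymmetricallyRealizable n) := by
  have hl₁ : (l₁ : ℂ) ∈ eigenvalueList C := by rw [hspec]; simp
  have hμ : (a : ℂ) + b * Complex.I ∈ eigenvalueList C := by rw [hspec]; simp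
  have hn : 0 < n := by
    obtain ⟨x, hx, -⟩ := mem_eigenvalueList_iff.1 hμ
    obtain ⟨k, -⟩ := Function.ne_iff.1 hx
    exact k.pos
  obtain ⟨A, ρ, hA, hAc, hAρ, hAp, hAs⟩ := exists_cospectral_const_row_sums hn hnonneg hcentro
  have hAC := eigenvalueList_congr hAp
  have hASC := eigenvalueList_congr hAs
  -- Both are eigenvalues of the same list, and each bounds the modulus of every eigenvalue.
  have hρ : ρ = l₁ := by
    refine le_antisymm ?_ ?_
    · have := hperron ρ (hAC ▸ const_row_sum_mem_eigenvalueList hn hAρ)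
      rw [Complex.norm_real] at this
      exact (le_abs_self ρ).trans this
    · have := norm_le_of_const_row_sums hA hAρ (hAC ▸ hl₁)
      rw [Complex.norm_real] at this
      exact (le_abs_self l₁).trans this
  subst hρ
  rw [← hAC] at hspec hμ
  rw [← hASC]
  have hconj : (starRingEnd ℂ) ((a : ℂ) + b * Complex.I) = (a : ℂ) - b * Complex.I := by
    simp [sub_eq_add_neg]
  have key : ∀ {ε ρ' a' : ℝ}, a + ε * t = a' → (∃ N : Matrix (Fin n) (Fin n) ℝ,
      IsNonnegative N ∧ IsCentrosymmetric N ∧ N.charpoly * (X - Polynomial.C ρ) *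
        conjPairPoly a b = A.charpoly * (X - Polynomial.C ρ') * conjPairPoly (a + ε * t) b) →
      (ρ' : ℂ) ::ₘ ((a' : ℂ) + b * Complex.I) ::ₘ ((a' : ℂ) - b * Complex.I) ::ₘ L ∈
        centrosymmetricallyRealizable n := by
    rintro ε ρ' a' rfl ⟨N, hN, hNc, hNp⟩
    exact ⟨N, hN, hNc, eigenvalueList_of_charpoly_eq hspec hNp⟩
  have hskew : (a : ℂ) + b * Complex.I ∈ eigenvalueList (skewSymmetricBlock A) →
      ∀ {ε a' : ℝ}, |ε| = 1 → a + ε * t = a' →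
      ((ρ + 2 * t : ℝ) : ℂ) ::ₘ ((a' : ℂ) + b * Complex.I) ::ₘ ((a' : ℂ) - b * Complex.I) ::ₘ L ∈
        centrosymmetricallyRealizable n := by
    intro hmem ε a' hε ha'
    obtain ⟨x, hx, hxs, h⟩ := (mem_eigenvalueList_skewSymmetricBlock_iff hAc).1 hmem
    exact key ha' (exists_shift_of_skew_eigenvector hA hAc hAρ hb.ne' hx hxs h ht hε)
  have hsym : (a : ℂ) + b * Complex.I ∉ eigenvalueList (skewSymmetricBlock A) →
      ∀ {ε a' ρ' : ℝ}, |ε| = 1 → a + ε * t = a' → ρ + ε * t + 3 * t = ρ' →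
      (ρ' : ℂ) ::ₘ ((a' : ℂ) + b * Complex.I) ::ₘ ((a' : ℂ) - b * Complex.I) ::ₘ L ∈
        centrosymmetricallyRealizable n := by
    intro hmem ε a' ρ' hε ha' hρ'
    obtain ⟨s, hs, x, hx, hxs, h⟩ := exists_symmetric_or_skew_eigenvector hAc hμ
    rcases hs with rfl | rfl
    · subst hρ'
      exact key ha' (exists_shift_of_symmetric_eigenvector hA hAc hAρ hb.ne' hx
        (fun i => by simpa using hxs i) h ht hε)
    · exact absurd ((mem_eigenvalueList_skewSymmetricBlock_iff hAc).2
        ⟨x, hx, fun i => by simpa using hxs i, h⟩) hmem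
  refine ⟨?_, fun h => ?_, fun h => ?_⟩
  -- For the left shift both parities cost `2t`, since `-t + 3t = 2t`.
  · by_cases hmem : (a : ℂ) + b * Complex.I ∈ eigenvalueList (skewSymmetricBlock A)
    · exact hskew hmem (ε := -1) (by simp) (by ring)
    · exact hsym hmem (ε := -1) (by simp) (by ring) (by ring)
  · exact hskew h.1 (ε := 1) (by simp) (by ring)
  -- The block is real, so having one of `a ± ib` as an eigenvalue would give both.
  · have hmem : (a : ℂ) + b * Complex.I ∉ eigenvalueList (skewSymmetricBlock A) := fun hm =>
      h ⟨hm, hconj ▸ conj_mem_eigenvalueList hm⟩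
    exact hsym hmem (ε := 1) (by simp) (by ring) (by ring)
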